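/- For $p\ge 1$ and a probability distribution $P$ on $\mathbb{R}^p$ with $X\sim P$, let $f_P(v)=\mathrm{E}\left(\|X-v\|\,\|X+v\|-\|X\|^2\right)$, $v\in\mathbb{R}^p$, where $\|\cdot\|$ is the Euclidean norm (the expectation is always finite). Let $O=(o_1,\ldots,o_p)$ be an orthogonal $p\times p$ matrix and $\Lambda=\sigma\,\mathrm{diag}(\lambda,1,\ldots,1)$ with $\sigma>0$ and $\lambda>1$. Write $P\in\mathcal{E}(O,\Lambda)$ if $P$ is the distribution of $X=O\Lambda Z$, where $Z$ is a random $p$-vector such that: $Z$ and $VZ$ have the same distribution for every orthogonal $p\times p$ matrix $V$; $R=\|Z\|$ has a Lebesgue density $f_R:(0,\infty)\to(0,\infty)$; the map $r\mapsto f_R(r)/r^{p-1}$ is strictly decreasing on $(0,\infty)$; and $\mathrm{E}(R)<\infty$. A number $\psi\ge 0$ is called the norm of the minimizer of $f_P$ if the global minimizers of $f_P$ are precisely the vectors $\pm\psi o_1$; it is denoted $\psi(\lambda,p)$, the dependence on $\sigma$ and on the distribution of $Z$ being suppressed. (1) For every $\lambda>1$ there is $N$, depending only on $\lambda$, such that for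 all $p\ge N$, all $\sigma>0$, all orthogonal $O$ and all $P\in\mathcal{E}(O,\Lambda)$ with $\Lambda=\sigma\,\mathrm{diag}(\lambda,1,\ldots,1)$, we have $\psi(\lambda,p)=0$; that is, $v=0$ is the unique minimizer of $f_P$. (2) Fix $p\ge 1$, $\sigma>0$ and a distribution of $Z$ as above. For every $\varepsilon>0$ and all sufficiently large $\lambda$, there is a number $\psi(\lambda,p)$, the same for all orthogonal $O$, that is the norm of the minimizer of $f_P$ for the distribution $P$ of $X=O\Lambda Z$ with $\Lambda=\sigma\,\mathrm{diag}(\lambda,1,\ldots,1)$, and it satisfies $$\lambda^{1-\varepsilon}<\psi(\lambda,p)<\lambda^{1+\varepsilon}.$$ -/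

import Mathlib

open MeasureTheory Filter

/-- The vector space `ℝ^p` with the Euclidean norm. -/
abbrev RVec (p : ℕ) : Type := EuclideanSpace ℝ (Fin p)

/-- The linear map `x ↦ A x` of `ℝ^p` given by a `p × p` matrix `A`. -/
noncomputable def matAct {p : ℕ} (A : Matrix (Fin p) (Fin p) ℝ) : RVec p →ₗ[ℝ] RVec p :=
  Matrix.toEuclideanLin A

/-- The objective function `f_P(v) = E (‖X - v‖ ‖X + v‖ - ‖X‖²)`, `X ∼ P`. For a probability
measure `P` the integrand is bounded in absolute value by `‖v‖²`, so the integral always exists. -/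
noncomputable def objective {p : ℕ} (P : Measure (RVec p)) (v : RVec p) : ℝ :=
  ∫ x, (‖x - v‖ * ‖x + v‖ - ‖x‖ ^ 2) ∂P

/-- The set of global minimizers of `f_P` over `ℝ^p`. -/
def minimizers {p : ℕ} (P : Measure (RVec p)) : Set (RVec p) :=
  {v | ∀ w, objective P v ≤ objective P w}

/-- The diagonal matrix `σ diag(lam, 1, …, 1)`. -/
def scaleMatrix (p : ℕ) [NeZero p] (σ lam : ℝ) : Matrix (Fin p) (Fin p) ℝ :=
  σ • Matrix.diagonal (fun i => if i = 0 then lam else 1)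

/-- The law of a `p`-vector `Z` is spherical: `Z` and `V Z` have the same distribution for every
orthogonal matrix `V`. -/
def IsSpherical {p : ℕ} (ν : Measure (RVec p)) : Prop :=
  ∀ V ∈ Matrix.orthogonalGroup (Fin p) ℝ, ν.map (matAct V) = ν

/-- The conditions on the law `ν` of the random vector `Z` in the elliptical family: it is a
spherical probability law, and `R = ‖Z‖` has a density `fR : (0, ∞) → (0, ∞)` with respect to the
Lebesgue measure such that `r ↦ fR r / r ^ (p - 1)` is strictly decreasing, and `E R < ∞`. -/
structure IsGenerator {p : ℕ} [NeZero p] (ν : Measure (RVec p)) : Prop where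
  prob : IsProbabilityMeasure ν
  spherical : IsSpherical ν
  radial_density : ∃ fR : ℝ → ℝ,
    (∀ r, 0 < r → 0 < fR r) ∧
    ν.map (fun z => ‖z‖) =
      (volume.restrict (Set.Ioi (0 : ℝ))).withDensity (fun r => ENNReal.ofReal (fR r)) ∧
    StrictAntiOn (fun r => fR r / r ^ (p - 1)) (Set.Ioi 0)
  integrable_norm : Integrable (fun z => ‖z‖) ν

/-- The law of `O Λ Z`, where `Z ∼ ν`. -/
noncomputable def ellipticalLaw {p : ℕ} (O Λ : Matrix (Fin p) (Fin p) ℝ)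
    (ν : Measure (RVec p)) : Measure (RVec p) :=
  ν.map (matAct (O * Λ))

/-- The family `𝓔(O, Λ)` of the laws of `X = O Λ Z` with `Z` as in `IsGenerator`. -/
def EllipticalFamily {p : ℕ} [NeZero p] (O Λ : Matrix (Fin p) (Fin p) ℝ) :
    Set (Measure (RVec p)) :=
  {P | ∃ ν : Measure (RVec p), IsGenerator ν ∧ P = ellipticalLaw O Λ ν}

/-- The first column `o₁` of the matrix `O`. -/
def firstColumn {p : ℕ} [NeZero p] (O : Matrix (Fin p) (Fin p) ℝ) : RVec p :=
  WithLp.toLp 2 (fun i => O i 0)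

/-- `ψ ≥ 0` is the norm of the minimizer of `f_P`: the minimizers of `f_P` are precisely the
vectors `± ψ o₁` (for a unit vector `o₁` this determines `ψ`; `ψ = 0` says that `0` is the
unique minimizer). -/
def IsMinimizerNorm {p : ℕ} (P : Measure (RVec p)) (o₁ : RVec p) (ψ : ℝ) : Prop :=
  0 ≤ ψ ∧ minimizers P = {ψ • o₁, -(ψ • o₁)}

/-! Everything rests on `sq_norm_sub_mul_norm_add`: once the norms of `x` and `v` are fixed, the
integrand depends only on the squared inner product, and decreases in it.

Part (1): the tangent bound `le_norm_sub_mul_norm_add_sub_sq` at `v = 0` is integrated. Sphericity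
spreads the squared direction cosines evenly over `p` coordinates, so the objective is at least `(1
- 2 * lam ^ 2 / p) * ‖v‖ ^ 2`, which is positive for `p > 2 * lam ^ 2` (`objective_pos_of_lt`).

Part (2): `Λ Z` has a density that decreases strictly across ellipsoids with long axis `e₁`
(`exists_density_map_scaleMatrix`). A reflection argument then shows that on each sphere only `± s
e₁` minimize (`objective_lt_of_density`). Along that axis the objective is strictly midpoint convex
in the squared norm (`two_mul_objective_lt`), so coercivity gives one minimizer up to sign. Its norm
has exact order `lam`: the objective is positive beyond a multiple of `σ * lam`, while somewhere it
lies below a negative multiple of `(σ * lam) ^ 2` and it is never below `-‖v‖ ^ 2`. Constants are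
absorbed by `lam ^ ε`. -/

/-! ### The integrand of the objective function -/

section Integrand

variable {E : Type*} [NormedAddCommGroup E] [InnerProductSpace ℝ E]

lemma sq_norm_sub_mul_norm_add (x v : E) :
    (‖x - v‖ * ‖x + v‖) ^ 2 = (‖x‖ ^ 2 + ‖v‖ ^ 2) ^ 2 - 4 * (inner ℝ x v) ^ 2 := by
  rw [mul_pow, norm_sub_sq_real, norm_add_sq_real]; ring

lemma norm_sub_mul_norm_add_le (x v : E) : ‖x - v‖ * ‖x + v‖ ≤ ‖x‖ ^ 2 + ‖v‖ ^ 2 := by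
  refine abs_le_of_sq_le_sq' ?_ (by positivity) |>.2
  rw [sq_norm_sub_mul_norm_add]
  nlinarith [sq_nonneg (inner ℝ x v)]

lemma abs_sq_sub_sq_le_norm_sub_mul_norm_add (x v : E) :
    |‖x‖ ^ 2 - ‖v‖ ^ 2| ≤ ‖x - v‖ * ‖x + v‖ := by
  refine abs_le_of_sq_le_sq ?_ (by positivity)
  rw [sq_norm_sub_mul_norm_add]
  have h := abs_real_inner_le_norm x v
  have h2 : (inner ℝ x v) ^ 2 ≤ (‖x‖ * ‖v‖) ^ 2 := sq_le_sq' (abs_le.1 h).1 (abs_le.1 h).2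
  nlinarith

lemma abs_norm_sub_mul_norm_add_sub_sq_le (x v : E) :
    |‖x - v‖ * ‖x + v‖ - ‖x‖ ^ 2| ≤ ‖v‖ ^ 2 := by
  have h1 := norm_sub_mul_norm_add_le x v
  have h2 := (abs_le.1 (abs_sq_sub_sq_le_norm_sub_mul_norm_add x v)).2
  rw [abs_le]; constructor <;> linarith

/-- The tangent line bound at `v = 0`. -/
lemma le_norm_sub_mul_norm_add_sub_sq (x v : E) :
    ‖v‖ ^ 2 - 2 * ((inner ℝ x v) ^ 2 / ‖x‖ ^ 2) ≤ ‖x - v‖ * ‖x + v‖ - ‖x‖ ^ 2 := by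
  rcases eq_or_ne x 0 with rfl | hx
  · simp [sq]
  have hx : 0 < ‖x‖ ^ 2 := by positivity
  have h := abs_real_inner_le_norm x v
  have h2 : (inner ℝ x v) ^ 2 ≤ (‖x‖ * ‖v‖) ^ 2 := sq_le_sq' (abs_le.1 h).1 (abs_le.1 h).2
  -- With `d` the squared length of the projection of `v` on the line of `x`, the two squares differ
  -- by `4 * d * (‖v‖ ^ 2 - d)`.
  have key : ‖x‖ ^ 2 + ‖v‖ ^ 2 - 2 * ((inner ℝ x v) ^ 2 / ‖x‖ ^ 2) ≤ ‖x - v‖ * ‖x + v‖ := by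
    refine le_of_abs_le (abs_le_of_sq_le_sq ?_ (by positivity))
    rw [sq_norm_sub_mul_norm_add]
    obtain ⟨d, hd⟩ : ∃ d, d = (inner ℝ x v) ^ 2 / ‖x‖ ^ 2 := ⟨_, rfl⟩
    have hd' : (inner ℝ x v) ^ 2 = d * ‖x‖ ^ 2 := by rw [hd]; field_simp
    have hd0 : 0 ≤ d := hd ▸ by positivity
    have hdv : d ≤ ‖v‖ ^ 2 := by
      rw [hd, div_le_iff₀ hx]; nlinarith
    rw [← hd, hd']
    nlinarith
  linarith

/-- Along a ray, the integrand is midpoint convex as a function of the squared norm. -/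
lemma norm_sub_mul_norm_add_midpoint_le (x e : E) (he : ‖e‖ = 1) {r s t : ℝ}
    (h : 2 * r ^ 2 = s ^ 2 + t ^ 2) :
    2 * (‖x - r • e‖ * ‖x + r • e‖) ≤
      ‖x - s • e‖ * ‖x + s • e‖ + ‖x - t • e‖ * ‖x + t • e‖ := by
  -- Completing the square in `u ^ 2` makes the product the modulus of a complex number whose real
  -- part is `u ^ 2 + b` and whose imaginary part is constant. Convexity in `u ^ 2` is then the
  -- triangle inequality.
  set b := ‖x‖ ^ 2 - 2 * (inner ℝ x e) ^ 2
  have hd : 0 ≤ (‖x‖ ^ 2) ^ 2 - b ^ 2 := by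
    have h := abs_real_inner_le_norm x e
    rw [he, mul_one] at h
    have h2 : (inner ℝ x e) ^ 2 ≤ ‖x‖ ^ 2 := sq_le_sq' (abs_le.1 h).1 (abs_le.1 h).2
    simp only [b]
    nlinarith [sq_nonneg (inner ℝ x e)]
  have key (u : ℝ) : ‖x - u • e‖ * ‖x + u • e‖
      = ‖(⟨u ^ 2 + b, √((‖x‖ ^ 2) ^ 2 - b ^ 2)⟩ : ℂ)‖ := by
    rw [← abs_of_nonneg (mul_nonneg (norm_nonneg (x - u • e)) (norm_nonneg (x + u • e))),
      ← abs_of_nonneg (norm_nonneg (⟨_, _⟩ : ℂ)), ← sq_eq_sq_iff_abs_eq_abs,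
      sq_norm_sub_mul_norm_add, ← Complex.normSq_eq_norm_sq, Complex.normSq_apply,
      Real.mul_self_sqrt hd, norm_smul, he, inner_smul_right, mul_one, Real.norm_eq_abs, sq_abs]
    simp only [b]; ring
  rw [key, key, key]
  refine le_trans (le_of_eq ?_) (norm_add_le _ _)
  rw [show (2 : ℝ) = ‖(2 : ℂ)‖ by simp, ← norm_mul]
  congr 1
  apply Complex.ext <;> simp
  · linarith
  · ring

lemma norm_sub_mul_norm_add_lt_of_abs_inner_lt (x : E) {v w : E} (hvw : ‖v‖ = ‖w‖)
    (h : |inner ℝ x w| < |inner ℝ x v|) : ‖x - v‖ * ‖x + v‖ < ‖x - w‖ * ‖x + w‖ := by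
  refine lt_of_pow_lt_pow_left₀ 2 (by positivity) ?_
  rw [sq_norm_sub_mul_norm_add, sq_norm_sub_mul_norm_add, hvw]
  have := sq_lt_sq.2 h
  linarith

lemma norm_sub_mul_norm_add_eq_of_abs_inner_eq (x : E) {v w : E} (hvw : ‖v‖ = ‖w‖)
    (h : |inner ℝ x w| = |inner ℝ x v|) : ‖x - v‖ * ‖x + v‖ = ‖x - w‖ * ‖x + w‖ := by
  rw [← abs_of_nonneg (by positivity : 0 ≤ ‖x - v‖ * ‖x + v‖),
    ← abs_of_nonneg (by positivity : 0 ≤ ‖x - w‖ * ‖x + w‖), ← sq_eq_sq_iff_abs_eq_abs,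
    sq_norm_sub_mul_norm_add, sq_norm_sub_mul_norm_add, hvw, (sq_eq_sq_iff_abs_eq_abs _ _).2 h]

end Integrand

/-! ### The objective function -/

section Objective

variable {p : ℕ}

lemma integrable_objective (P : Measure (RVec p)) [IsFiniteMeasure P] (v : RVec p) :
    Integrable (fun x => ‖x - v‖ * ‖x + v‖ - ‖x‖ ^ 2) P :=
  Integrable.of_bound (by fun_prop) (‖v‖ ^ 2)
    (.of_forall fun x => by simpa using abs_norm_sub_mul_norm_add_sub_sq_le x v)

lemma continuous_objective (P : Measure (RVec p)) [IsFiniteMeasure P] :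
    Continuous (objective P) := by
  rw [continuous_iff_continuousAt]
  intro v
  refine continuousAt_of_dominated (bound := fun _ => (‖v‖ + 1) ^ 2)
    (.of_forall fun w => (integrable_objective P w).aestronglyMeasurable) ?_
    (integrable_const _) (.of_forall fun x => by fun_prop)
  filter_upwards [Metric.ball_mem_nhds v one_pos] with w hw
  refine .of_forall fun x => ?_
  rw [Real.norm_eq_abs]
  refine (abs_norm_sub_mul_norm_add_sub_sq_le x w).trans ?_
  have : ‖w‖ ≤ ‖v‖ + 1 := by
    have := norm_sub_norm_le w v
    rw [mem_ball_iff_norm] at hw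
    linarith
  gcongr

@[simp] lemma objective_zero (P : Measure (RVec p)) : objective P 0 = 0 := by
  simp [objective, sq]

@[simp] lemma objective_neg (P : Measure (RVec p)) (v : RVec p) :
    objective P (-v) = objective P v := by
  simp only [objective, sub_neg_eq_add, ← sub_eq_add_neg]
  simp_rw [mul_comm]

lemma neg_sq_norm_le_objective (P : Measure (RVec p)) [IsProbabilityMeasure P] (v : RVec p) :
    -‖v‖ ^ 2 ≤ objective P v := by
  have := integral_mono (μ := P) (integrable_const (-‖v‖ ^ 2)) (integrable_objective P v)
    fun x => (abs_le.1 (abs_norm_sub_mul_norm_add_sub_sq_le x v)).1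
  simpa [objective] using this

lemma objective_map (P : Measure (RVec p)) (T : RVec p →ₗ[ℝ] RVec p) (v : RVec p) :
    objective (P.map T) v = ∫ z, (‖T z - v‖ * ‖T z + v‖ - ‖T z‖ ^ 2) ∂P := by
  rw [objective, integral_map]
  · exact (LinearMap.continuous_of_finiteDimensional T).aemeasurable
  · fun_prop

lemma objective_map_isometry (P : Measure (RVec p)) (T : RVec p ≃ₗᵢ[ℝ] RVec p) (v : RVec p) :
    objective (P.map T) (T v) = objective P v := by
  refine (objective_map P T.toLinearEquiv.toLinearMap (T v)).trans ?_
  simp [objective, ← map_sub, ← map_add]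

lemma IsMinimizerNorm.map_isometry {P : Measure (RVec p)} {e : RVec p} {ψ : ℝ}
    (h : IsMinimizerNorm P e ψ) (T : RVec p ≃ₗᵢ[ℝ] RVec p) :
    IsMinimizerNorm (P.map T) (T e) ψ := by
  refine ⟨h.1, ?_⟩
  have key (v : RVec p) : T v ∈ minimizers (P.map T) ↔ v ∈ minimizers P := by
    simp only [minimizers, Set.mem_ofPred_eq]
    rw [T.surjective.forall]
    simp_rw [objective_map_isometry]
  ext v
  obtain ⟨v, rfl⟩ := T.surjective v
  rw [key, h.2]
  simp only [Set.mem_insert_iff, Set.mem_singleton_iff, ← map_smul, ← map_neg,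
    T.injective.eq_iff]

end Objective

/-! ### Orthogonal matrices and linear isometries -/

section Isometry

variable {p : ℕ}

lemma matAct_apply (A : Matrix (Fin p) (Fin p) ℝ) (x : RVec p) (i : Fin p) :
    matAct A x i = ∑ j, A i j * x j := by
  simp [matAct, Matrix.mulVec, dotProduct]

lemma matAct_mul (A B : Matrix (Fin p) (Fin p) ℝ) (x : RVec p) :
    matAct (A * B) x = matAct A (matAct B x) := by
  simp [matAct, Matrix.toLpLin_apply, Matrix.mulVec_mulVec]

lemma continuous_matAct (A : Matrix (Fin p) (Fin p) ℝ) : Continuous (matAct A) :=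
  LinearMap.continuous_of_finiteDimensional _

/-- The linear isometry given by an orthogonal matrix. -/
lemma exists_isometry_of_mem_orthogonalGroup {O : Matrix (Fin p) (Fin p) ℝ}
    (hO : O ∈ Matrix.orthogonalGroup (Fin p) ℝ) :
    ∃ T : RVec p ≃ₗᵢ[ℝ] RVec p, ∀ x, T x = matAct O x := by
  have h1 : star O * O = 1 := (Matrix.mem_orthogonalGroup_iff' _ _).1 hO
  have hn (x : RVec p) : ‖matAct O x‖ = ‖x‖ := by
    rw [← sq_eq_sq₀ (norm_nonneg _) (norm_nonneg _), ← real_inner_self_eq_norm_sq,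
      ← real_inner_self_eq_norm_sq]
    have h2 : (star O).mulVec (O.mulVec x.ofLp) = x.ofLp := by
      rw [Matrix.mulVec_mulVec, h1, Matrix.one_mulVec]
    simp only [EuclideanSpace.inner_eq_star_dotProduct, star_trivial, matAct,
      Matrix.ofLp_toLpLin, Matrix.toLin'_apply]
    rw [Matrix.dotProduct_mulVec, ← Matrix.mulVec_transpose]
    congr 1
  exact ⟨LinearIsometry.toLinearIsometryEquiv ⟨matAct O, hn⟩ rfl, fun x => rfl⟩

/-- Every linear isometry comes from an orthogonal matrix; this makes reflections available without
matrix computations. -/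
lemma IsSpherical.map_isometry {ν : Measure (RVec p)} (hν : IsSpherical ν)
    (T : RVec p ≃ₗᵢ[ℝ] RVec p) : ν.map T = ν := by
  let M : Matrix (Fin p) (Fin p) ℝ := Matrix.toEuclideanLin.symm T.toLinearEquiv.toLinearMap
  have hM : matAct M = T.toLinearEquiv.toLinearMap := Matrix.toEuclideanLin.apply_symm_apply _
  have hcol (i j : Fin p) : M i j = T (EuclideanSpace.single j 1) i := by
    have := matAct_apply M (EuclideanSpace.single j 1) i
    rw [hM] at this
    simpa [Pi.single_apply] using this.symm
  have hO : M ∈ Matrix.orthogonalGroup (Fin p) ℝ := by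
    rw [Matrix.mem_orthogonalGroup_iff']
    ext i j
    have h := T.inner_map_map (EuclideanSpace.single i 1) (EuclideanSpace.single j 1)
    rw [Matrix.mul_apply, Matrix.one_apply]
    change ∑ k, M k i * M k j = _
    simp only [hcol]
    simp only [PiLp.inner_apply, RCLike.inner_apply, conj_trivial] at h
    simp_rw [mul_comm (T (EuclideanSpace.single i 1) _)]
    rw [h]
    simp [eq_comm]
  have := hν M hO
  rwa [hM] at this

lemma IsSpherical.integral_comp_isometry {ν : Measure (RVec p)} (hν : IsSpherical ν)
    (T : RVec p ≃ₗᵢ[ℝ] RVec p) {F : Type*} [NormedAddCommGroup F] [NormedSpace ℝ F]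
    (f : RVec p → F) : ∫ z, f (T z) ∂ν = ∫ z, f z ∂ν := by
  conv_rhs => rw [← hν.map_isometry T]
  exact (integral_map_equiv T.toHomeomorph.toMeasurableEquiv f).symm

/-- The isometry group is transitive on spheres. -/
lemma exists_isometry_apply_eq {v w : RVec p} (h : ‖v‖ = ‖w‖) :
    ∃ T : RVec p ≃ₗᵢ[ℝ] RVec p, T v = w ∧ T w = v :=
  -- The reflection that exchanges `v` and `w`; being an involution, it maps both ways.
  have hT := Submodule.reflection_sub h
  ⟨_, hT, by
    have := Submodule.reflection_reflection (Submodule.span ℝ {v - w})ᗮ v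
    rwa [hT] at this⟩

lemma matAct_scaleMatrix_apply [NeZero p] (σ lam : ℝ) (x : RVec p) (i : Fin p) :
    matAct (scaleMatrix p σ lam) x i = σ * (if i = 0 then lam else 1) * x i := by
  rw [matAct_apply, scaleMatrix]
  simp [Matrix.diagonal_apply, mul_assoc]

lemma matAct_firstColumn [NeZero p] (O : Matrix (Fin p) (Fin p) ℝ) :
    matAct O (EuclideanSpace.single 0 1) = firstColumn O := by
  ext i
  rw [matAct_apply]
  simp [firstColumn]

/-- It suffices to treat the case of the identity matrix `O`. -/
lemma IsMinimizerNorm.ellipticalLaw [NeZero p] {ν : Measure (RVec p)}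
    {Λ O : Matrix (Fin p) (Fin p) ℝ} {ψ : ℝ}
    (h : IsMinimizerNorm (ν.map (matAct Λ)) (EuclideanSpace.single 0 1) ψ)
    (hO : O ∈ Matrix.orthogonalGroup (Fin p) ℝ) :
    IsMinimizerNorm (ellipticalLaw O Λ ν) (firstColumn O) ψ := by
  obtain ⟨T, hT⟩ := exists_isometry_of_mem_orthogonalGroup hO
  have := h.map_isometry T
  rw [hT, matAct_firstColumn, Measure.map_map T.continuous.measurable
    (continuous_matAct Λ).measurable] at this
  convert this using 1
  rw [_root_.ellipticalLaw]
  congr 1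
  ext1 x
  simp [matAct_mul, hT]

end Isometry

/-! ### High dimension -/

section HighDimension

variable {p : ℕ} {ν : Measure (RVec p)}

lemma integrable_sq_inner_div [IsFiniteMeasure ν] (w : RVec p) :
    Integrable (fun z : RVec p => (inner ℝ z w) ^ 2 / ‖z‖ ^ 2) ν := by
  refine Integrable.of_bound (Measurable.aestronglyMeasurable (by fun_prop)) (‖w‖ ^ 2) (.of_forall fun z => ?_)
  rw [Real.norm_of_nonneg (by positivity)]
  rcases eq_or_ne z 0 with rfl | hz
  · simp
  rw [div_le_iff₀ (by positivity), ← mul_pow, mul_comm]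
  exact sq_le_sq' (abs_le.1 (abs_real_inner_le_norm z w)).1 (real_inner_le_norm z w)

/-- By symmetry `w` may be turned to any coordinate axis, so all `p` axes give the same integral,
and the squared direction cosines sum to at most one. The sum is zero at `z = 0`, where division by
zero gives zero. -/
lemma IsSpherical.mul_integral_sq_inner_div_le [IsProbabilityMeasure ν] (hν : IsSpherical ν)
    (w : RVec p) : p * ∫ z, (inner ℝ z w) ^ 2 / ‖z‖ ^ 2 ∂ν ≤ ‖w‖ ^ 2 := by
  have h1 (i : Fin p) : ∫ z, (inner ℝ z w) ^ 2 / ‖z‖ ^ 2 ∂ν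
      = ∫ z, ‖w‖ ^ 2 * (z i ^ 2 / ‖z‖ ^ 2) ∂ν := by
    obtain ⟨T, hT, -⟩ := exists_isometry_apply_eq
      (v := ‖w‖ • EuclideanSpace.single i (1 : ℝ)) (w := w) (by simp [norm_smul])
    rw [← hν.integral_comp_isometry T]
    refine integral_congr_ae (.of_forall fun z => ?_)
    have : inner ℝ (T z) w = ‖w‖ * z i := by
      conv_lhs => rw [← hT, T.inner_map_map]
      simp [inner_smul_right, EuclideanSpace.inner_single_right]
    simp only [this, T.norm_map]
    ring
  have hint (i : Fin p) : Integrable (fun z : RVec p => z i ^ 2 / ‖z‖ ^ 2) ν := by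
    simpa [EuclideanSpace.inner_single_right] using
      integrable_sq_inner_div (ν := ν) (EuclideanSpace.single i (1 : ℝ))
  calc p * ∫ z, (inner ℝ z w) ^ 2 / ‖z‖ ^ 2 ∂ν
      = ∑ i : Fin p, ∫ z, (inner ℝ z w) ^ 2 / ‖z‖ ^ 2 ∂ν := by simp
    _ = ∑ i : Fin p, ∫ z, ‖w‖ ^ 2 * (z i ^ 2 / ‖z‖ ^ 2) ∂ν := Finset.sum_congr rfl fun i _ => h1 i
    _ = ∫ z, ∑ i : Fin p, ‖w‖ ^ 2 * (z i ^ 2 / ‖z‖ ^ 2) ∂ν :=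
      (integral_finsetSum _ fun i _ => (hint i).const_mul _).symm
    _ ≤ ∫ _, ‖w‖ ^ 2 ∂ν := by
      refine integral_mono (integrable_finsetSum _ fun i _ => (hint i).const_mul _)
        (integrable_const _) fun z => ?_
      simp only [← Finset.mul_sum, ← Finset.sum_div, ← EuclideanSpace.real_norm_sq_eq]
      exact mul_le_of_le_one_right (by positivity) (div_self_le_one _)
    _ = ‖w‖ ^ 2 := by simp

lemma inner_matAct_scaleMatrix [NeZero p] (σ lam : ℝ) (x y : RVec p) :
    inner ℝ (matAct (scaleMatrix p σ lam) x) y = inner ℝ x (matAct (scaleMatrix p σ lam) y) := by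
  simp only [PiLp.inner_apply, RCLike.inner_apply, conj_trivial, matAct_scaleMatrix_apply]
  exact Finset.sum_congr rfl fun i _ => by ring

lemma norm_matAct_scaleMatrix_le [NeZero p] {σ lam : ℝ} (hσ : 0 < σ) (hl : 1 ≤ lam) (x : RVec p) :
    ‖matAct (scaleMatrix p σ lam) x‖ ≤ σ * lam * ‖x‖ := by
  refine le_of_sq_le_sq ?_ (by positivity)
  rw [mul_pow, EuclideanSpace.real_norm_sq_eq, EuclideanSpace.real_norm_sq_eq, Finset.mul_sum]
  refine Finset.sum_le_sum fun i _ => ?_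
  rw [matAct_scaleMatrix_apply, mul_pow]
  gcongr
  split_ifs <;> linarith

lemma le_norm_matAct_scaleMatrix [NeZero p] {σ lam : ℝ} (hσ : 0 < σ) (hl : 1 ≤ lam) (x : RVec p) :
    σ * ‖x‖ ≤ ‖matAct (scaleMatrix p σ lam) x‖ := by
  refine le_of_sq_le_sq ?_ (norm_nonneg _)
  rw [mul_pow, EuclideanSpace.real_norm_sq_eq, EuclideanSpace.real_norm_sq_eq, Finset.mul_sum]
  refine Finset.sum_le_sum fun i _ => ?_
  rw [matAct_scaleMatrix_apply, mul_pow]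
  gcongr
  split_ifs <;> nlinarith

lemma objective_pos_of_lt [NeZero p] [IsProbabilityMeasure ν] (hν : IsSpherical ν)
    {σ lam : ℝ} (hσ : 0 < σ) (hl : 1 ≤ lam) (hp : 2 * lam ^ 2 < p) {v : RVec p} (hv : v ≠ 0) :
    0 < objective (ν.map (matAct (scaleMatrix p σ lam))) v := by
  rw [objective_map]
  set A := matAct (scaleMatrix p σ lam)
  have hA : Measurable A := (continuous_matAct _).measurable
  have hvp : 0 < ‖v‖ := norm_pos_iff.2 hv
  have hI := (integrable_sq_inner_div (ν := ν) (A v)).const_mul (2 / σ ^ 2)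
  have hint : Integrable (fun z => ‖A z - v‖ * ‖A z + v‖ - ‖A z‖ ^ 2) ν :=
    Integrable.of_bound (by fun_prop) (‖v‖ ^ 2)
      (.of_forall fun x => by simpa using abs_norm_sub_mul_norm_add_sub_sq_le (A x) v)
  have h1 : ∫ z, (‖v‖ ^ 2 - 2 / σ ^ 2 * ((inner ℝ z (A v)) ^ 2 / ‖z‖ ^ 2)) ∂ν ≤
      ∫ z, (‖A z - v‖ * ‖A z + v‖ - ‖A z‖ ^ 2) ∂ν := by
    refine integral_mono ((integrable_const _).sub hI) hint fun z => ?_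
    refine le_trans ?_ (le_norm_sub_mul_norm_add_sub_sq (A z) v)
    rcases eq_or_ne z 0 with rfl | hz
    · simp
    rw [inner_matAct_scaleMatrix]
    have h2 := le_norm_matAct_scaleMatrix hσ hl z
    have h3 : (inner ℝ z (A v)) ^ 2 / ‖A z‖ ^ 2 ≤ (inner ℝ z (A v)) ^ 2 / (σ * ‖z‖) ^ 2 := by
      gcongr
    have h4 : 2 / σ ^ 2 * ((inner ℝ z (A v)) ^ 2 / ‖z‖ ^ 2) =
        2 * ((inner ℝ z (A v)) ^ 2 / (σ * ‖z‖) ^ 2) := by field_simp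
    simp only [h4]
    linarith
  refine lt_of_lt_of_le ?_ h1
  rw [integral_sub (integrable_const _) hI, integral_const_mul]
  simp only [integral_const, probReal_univ, one_smul, sub_pos]
  have h5 := hν.mul_integral_sq_inner_div_le (A v)
  have h6 := norm_matAct_scaleMatrix_le hσ hl v
  have h7 : ‖A v‖ ^ 2 ≤ (σ * lam * ‖v‖) ^ 2 := by gcongr
  set J := ∫ z, (inner ℝ z (A v)) ^ 2 / ‖z‖ ^ 2 ∂ν
  have hp0 : (0 : ℝ) < p := lt_of_le_of_lt (by positivity) hp
  rw [div_mul_eq_mul_div, div_lt_iff₀ (by positivity)]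
  refine lt_of_mul_lt_mul_left (a := (p : ℝ)) ?_ hp0.le
  calc p * (2 * J) ≤ 2 * lam ^ 2 * (‖v‖ ^ 2 * σ ^ 2) := by nlinarith
    _ < _ := by gcongr

lemma isMinimizerNorm_zero_of_objective_pos {P : Measure (RVec p)} {e : RVec p}
    (h : ∀ v, v ≠ 0 → 0 < objective P v) : IsMinimizerNorm P e 0 := by
  refine ⟨le_rfl, ?_⟩
  ext v
  simp only [minimizers, Set.mem_ofPred_eq, zero_smul, neg_zero, Set.pair_eq_singleton,
    Set.mem_singleton_iff]
  constructor
  · intro hv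
    by_contra hne
    exact absurd (hv 0) (by simpa using h v hne)
  · rintro rfl w
    rcases eq_or_ne w 0 with rfl | hw
    · rfl
    · simpa using (h w hw).le

end HighDimension

/-! ### The Lebesgue density of a spherical law -/

section Density

variable {p : ℕ}

lemma IsSpherical.charFun_eq {μ : Measure (RVec p)} (hμ : IsSpherical μ) {ξ η : RVec p}
    (h : ‖ξ‖ = ‖η‖) : charFun μ ξ = charFun μ η := by
  obtain ⟨T, hT, -⟩ := exists_isometry_apply_eq h
  rw [charFun_apply, charFun_apply, ← hμ.integral_comp_isometry T (fun x => Complex.exp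
    ((inner ℝ x η : ℝ) * Complex.I))]
  simp_rw [← hT, T.inner_map_map]

variable [NeZero p]

/-- The characteristic function of a spherical law is an integral over the radial law. -/
lemma IsSpherical.exists_charFun_eq_integral_norm {γ : Measure (RVec p)} [IsProbabilityMeasure γ]
    (hγ : IsSpherical γ) (h0 : γ {0} = 0) (ξ : RVec p) :
    ∃ k : ℝ → ℂ, ∀ μ : Measure (RVec p), IsProbabilityMeasure μ → IsSpherical μ →
      charFun μ ξ = ∫ r, k r ∂(μ.map (fun z => ‖z‖)) := by
  -- The normalized vector `y / ‖y‖` under `γ` plays the part of the uniform law on the unit sphere.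
  -- `K` does not involve `μ` and depends only on `‖x‖`.
  let K : RVec p → ℂ := fun x =>
    ∫ y, Complex.exp ((inner ℝ x (‖ξ‖ • ‖y‖⁻¹ • y) : ℝ) * Complex.I) ∂γ
  have hK {x x' : RVec p} (h : ‖x‖ = ‖x'‖) : K x = K x' := by
    obtain ⟨T, hT, -⟩ := exists_isometry_apply_eq h
    simp only [K]
    rw [← hγ.integral_comp_isometry T (fun y => Complex.exp
      ((inner ℝ x' (‖ξ‖ • ‖y‖⁻¹ • y) : ℝ) * Complex.I))]
    simp_rw [← hT, T.norm_map, ← map_smul, T.inner_map_map]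
  have hKm : Measurable K := by
    refine (StronglyMeasurable.integral_prod_right (f := fun x y => Complex.exp
      ((inner ℝ x (‖ξ‖ • ‖y‖⁻¹ • y) : ℝ) * Complex.I)) ?_).measurable
    exact Measurable.stronglyMeasurable (by fun_prop)
  let e : RVec p := EuclideanSpace.single 0 1
  have hkm : Measurable (fun r : ℝ => K (r • e)) := hKm.comp (by fun_prop)
  refine ⟨fun r => K (r • e), fun μ hμ hs => ?_⟩
  rw [integral_map (by fun_prop) hkm.aestronglyMeasurable]
  -- `charFun μ` is constant on spheres, hence equal to its average over directions; Fubini then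
  -- moves the average onto `x`.
  have h1 : ∀ᵐ y ∂γ, charFun μ ξ = charFun μ (‖ξ‖ • ‖y‖⁻¹ • y) := by
    have : ∀ᵐ y ∂γ, y ≠ 0 := by simpa [ae_iff] using h0
    filter_upwards [this] with y hy
    refine hs.charFun_eq ?_
    have : ‖y‖ ≠ 0 := norm_ne_zero_iff.2 hy
    simp [norm_smul, this]
  calc charFun μ ξ = ∫ _, charFun μ ξ ∂γ := by simp
    _ = ∫ y, charFun μ (‖ξ‖ • ‖y‖⁻¹ • y) ∂γ := integral_congr_ae h1
    _ = ∫ y, ∫ x, Complex.exp ((inner ℝ x (‖ξ‖ • ‖y‖⁻¹ • y) : ℝ) * Complex.I) ∂μ ∂γ := rfl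
    _ = ∫ x, K x ∂μ := by
      refine integral_integral_swap (f := fun y x => Complex.exp
        ((inner ℝ x (‖ξ‖ • ‖y‖⁻¹ • y) : ℝ) * Complex.I)) ?_
      refine Integrable.of_bound (Measurable.aestronglyMeasurable ?_) 1 (.of_forall fun q => ?_)
      · simp only [Function.uncurry_def]
        fun_prop
      · simp only [Function.uncurry_def, Complex.norm_exp_ofReal_mul_I, le_refl]
    _ = ∫ x, K (‖x‖ • e) ∂μ :=
      integral_congr_ae (.of_forall fun x => hK (by simp [e, norm_smul]))

/-- A spherical law is determined by its radial law. -/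
lemma IsSpherical.ext_of_map_norm_eq {μ ν : Measure (RVec p)} [IsProbabilityMeasure μ]
    [IsProbabilityMeasure ν] (hμ : IsSpherical μ) (hν : IsSpherical ν) (h0 : ν {0} = 0)
    (h : μ.map (fun z => ‖z‖) = ν.map (fun z => ‖z‖)) : μ = ν := by
  refine Measure.ext_of_charFun (funext fun ξ => ?_)
  obtain ⟨k, hk⟩ := hν.exists_charFun_eq_integral_norm h0 ξ
  rw [hk μ ‹_› hμ, hk ν ‹_› hν, h]

omit [NeZero p] in
lemma isSpherical_withDensity_norm (g : ℝ → ENNReal) :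
    IsSpherical ((volume : Measure (RVec p)).withDensity (fun z => g ‖z‖)) := by
  intro V hV
  obtain ⟨T, hT⟩ := exists_isometry_of_mem_orthogonalGroup hV
  have hTV : ⇑(matAct V) = T := funext fun x => (hT x).symm
  have hT' : MeasurableEmbedding T := T.toHomeomorph.measurableEmbedding
  rw [hTV]
  ext s hs
  rw [hT'.map_apply, withDensity_apply _ (hT'.measurable hs), withDensity_apply _ hs,
    ← T.measurePreserving.setLIntegral_comp_preimage_emb hT' (fun z => g ‖z‖) s]
  simp

/-- The radial density comes without a measurability assumption; monotonicity supplies it. -/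
lemma measurable_indicator_of_antitoneOn {f : ℝ → ℝ} (hf : AntitoneOn f (Set.Ioi 0)) :
    Measurable ((Set.Ioi (0 : ℝ)).indicator f) := by
  refine measurable_of_restrict_of_restrict_compl (measurableSet_Ioi (a := (0 : ℝ))) ?_ ?_
  · refine Antitone.measurable fun x y hxy => ?_
    simpa only [Set.domRestrict_apply, Set.indicator_of_mem x.2, Set.indicator_of_mem y.2]
      using hf x.2 y.2 hxy
  · convert measurable_const (a := (0 : ℝ)) using 1
    ext x
    exact Set.indicator_of_notMem x.2 _

/-- The radial law of a rotationally symmetric density. -/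
lemma map_norm_withDensity {g : ℝ → ℝ} (hg0 : ∀ r, 0 ≤ g r) {f : ℝ → ℝ}
    (hf : ∀ r, 0 < r → f r = p * (volume : Measure (RVec p)).real (Metric.ball 0 1) *
      (r ^ (p - 1) * g r))
    (hfi : IntegrableOn f (Set.Ioi 0)) :
    ((volume : Measure (RVec p)).withDensity (fun z => ENNReal.ofReal (g ‖z‖))).map
        (fun z => ‖z‖) =
      (volume.restrict (Set.Ioi (0 : ℝ))).withDensity (fun r => ENNReal.ofReal (f r)) := by
  -- `c` is the surface area of the unit sphere, from integration in polar coordinates.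
  set c := p * (volume : Measure (RVec p)).real (Metric.ball 0 1) with hc
  have hc0 : 0 < c := by
    refine mul_pos (by exact_mod_cast NeZero.pos p) ?_
    exact ENNReal.toReal_pos (Metric.measure_ball_pos _ _ one_pos).ne' measure_ball_lt_top.ne
  have hf0 : ∀ r, 0 < r → 0 ≤ f r := fun r hr => by
    rw [hf r hr]; exact mul_nonneg hc0.le (mul_nonneg (by positivity) (hg0 r))
  ext s hs
  have hnorm : Measurable (fun z : RVec p => ‖z‖) := measurable_norm
  rw [Measure.map_apply hnorm hs, withDensity_apply _ (hnorm hs), withDensity_apply _ hs,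
    ← lintegral_indicator (hnorm hs), ← lintegral_indicator hs]
  have e1 (z : RVec p) : ((fun z : RVec p => ‖z‖) ⁻¹' s).indicator
      (fun z => ENNReal.ofReal (g ‖z‖)) z = ENNReal.ofReal (s.indicator g ‖z‖) := by
    by_cases hz : ‖z‖ ∈ s <;> simp [Set.indicator, hz]
  have e2 (r : ℝ) : s.indicator (fun r => ENNReal.ofReal (f r)) r =
      ENNReal.ofReal (s.indicator f r) := by
    by_cases hz : r ∈ s <;> simp [Set.indicator, hz]
  simp_rw [e1, e2]
  have hfs : IntegrableOn (s.indicator f) (Set.Ioi 0) := hfi.indicator hs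
  have e3 : Set.EqOn (fun r => r ^ (p - 1) • s.indicator g r) (fun r => c⁻¹ * s.indicator f r)
      (Set.Ioi 0) := by
    intro r hr
    by_cases hz : r ∈ s
    · simp only [Set.indicator, hz, if_true, smul_eq_mul]
      rw [hf r hr]; field_simp
    · simp [Set.indicator, hz]
  have hint : Integrable (fun z : RVec p => s.indicator g ‖z‖) := by
    rw [integrable_fun_norm_addHaar (volume : Measure (RVec p)), finrank_euclideanSpace_fin]
    exact IntegrableOn.congr_fun (hfs.const_mul c⁻¹) e3.symm measurableSet_Ioi
  rw [← ofReal_integral_eq_lintegral_ofReal hint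
      (.of_forall fun z => Set.indicator_nonneg (fun _ _ => hg0 _) _),
    ← ofReal_integral_eq_lintegral_ofReal hfs, integral_fun_norm_addHaar volume,
    finrank_euclideanSpace_fin, setIntegral_congr_fun measurableSet_Ioi e3, integral_const_mul]
  · congr 1
    rw [nsmul_eq_mul, smul_eq_mul, ← mul_assoc, ← hc, mul_inv_cancel_left₀ hc0.ne']
  · filter_upwards [ae_restrict_mem measurableSet_Ioi] with r hr
    exact Set.indicator_apply_nonneg fun _ => hf0 r hr

/-- Only the norm of `Z` is assumed to have a density. Dividing it by the area of the sphere of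
radius `r` gives a spherical law with the same radial law, and such a law is unique. -/
lemma IsGenerator.exists_density {ν : Measure (RVec p)} (hν : IsGenerator ν) :
    ∃ g : ℝ → ℝ, Measurable g ∧ (∀ r, 0 ≤ g r) ∧ (∀ r, 0 < r → 0 < g r) ∧
      StrictAntiOn g (Set.Ioi 0) ∧
      ν = (volume : Measure (RVec p)).withDensity (fun z => ENNReal.ofReal (g ‖z‖)) := by
  obtain ⟨f, hf0, hf, hanti⟩ := hν.radial_density
  have := hν.prob
  set c := p * (volume : Measure (RVec p)).real (Metric.ball 0 1) with hc
  have hc0 : 0 < c := by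
    refine mul_pos (by exact_mod_cast NeZero.pos p) ?_
    exact ENNReal.toReal_pos (Metric.measure_ball_pos _ _ one_pos).ne' measure_ball_lt_top.ne
  let h : ℝ → ℝ := fun r => f r / r ^ (p - 1)
  have hm : Measurable ((Set.Ioi (0 : ℝ)).indicator h) :=
    measurable_indicator_of_antitoneOn hanti.antitoneOn
  let g : ℝ → ℝ := fun r => c⁻¹ * (Set.Ioi (0 : ℝ)).indicator h r
  have hgm : Measurable g := hm.const_mul _
  have hgh : ∀ r, 0 < r → g r = c⁻¹ * h r := fun r hr => by
    simp only [g]; rw [Set.indicator_of_mem (Set.mem_Ioi.2 hr)]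
  have hgpos : ∀ r, 0 < r → 0 < g r := fun r hr => by
    rw [hgh r hr]
    have := hf0 r hr
    positivity
  have hg0 : ∀ r, 0 ≤ g r := fun r => by
    rcases lt_or_ge 0 r with hr | hr
    · exact (hgpos r hr).le
    · simp only [g]; rw [Set.indicator_of_notMem (by simpa using hr), mul_zero]
  have hfg : ∀ r, 0 < r → f r = c * (r ^ (p - 1) * g r) := fun r hr => by
    rw [hgh r hr]; simp only [h]; field_simp
  have hfi : IntegrableOn f (Set.Ioi 0) := by
    have hfm : AEMeasurable f (volume.restrict (Set.Ioi 0)) := by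
      refine AEMeasurable.congr (f := fun r => c * (r ^ (p - 1) * g r)) (by fun_prop) ?_
      filter_upwards [ae_restrict_mem measurableSet_Ioi] with r hr
      exact (hfg r hr).symm
    refine ⟨hfm.aestronglyMeasurable, ?_⟩
    -- The integral of `f` is finite because it is the total mass of the radial law.
    rw [hasFiniteIntegral_iff_ofReal]
    · have := congrArg (fun m => m Set.univ) hf
      simp only [Measure.map_apply measurable_norm MeasurableSet.univ, Set.preimage_univ,
        measure_univ, withDensity_apply _ MeasurableSet.univ, Measure.restrict_univ] at this
      rw [← this]
      exact ENNReal.one_lt_top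
    · filter_upwards [ae_restrict_mem measurableSet_Ioi] with r hr
      exact (hf0 r hr).le
  have hmap := map_norm_withDensity (p := p) hg0 hfg hfi
  set ν' := (volume : Measure (RVec p)).withDensity (fun z => ENNReal.ofReal (g ‖z‖)) with hν'
  rw [← hf] at hmap
  have : IsProbabilityMeasure ν' := by
    constructor
    have := congrArg (fun m => m Set.univ) hmap
    simpa [Measure.map_apply measurable_norm MeasurableSet.univ] using this
  refine ⟨g, hgm, hg0, hgpos, ?_, ?_⟩
  · intro r hr s hs hrs
    rw [hgh r hr, hgh s hs]
    exact mul_lt_mul_of_pos_left (hanti hr hs hrs) (by positivity)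
  · refine (IsSpherical.ext_of_map_norm_eq
      (isSpherical_withDensity_norm fun r => ENNReal.ofReal (g r)) hν.spherical ?_ hmap).symm
    have h2 : ν.map (fun z => ‖z‖) {0} = 0 := by
      rw [hf]
      exact withDensity_absolutelyContinuous _ _ (by simp)
    rw [Measure.map_apply measurable_norm (measurableSet_singleton _)] at h2
    convert h2 using 2
    ext z; simp

end Density

/-! ### The density of the elliptical law and the direction of the minimizers -/

section Direction

variable {p : ℕ}

/-- A norm of `ℝ^p` whose balls are ellipsoids with axis of symmetry `e`. -/
noncomputable def ellipsoidalNorm (α β : ℝ) (e x : RVec p) : ℝ :=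
  √(α * ‖x‖ ^ 2 - β * (inner ℝ x e) ^ 2)

lemma ellipsoidalNorm_pos {α β : ℝ} (hβ : 0 < β) (hαβ : β < α) {e : RVec p}
    (he : ‖e‖ = 1) {x : RVec p} (hx : x ≠ 0) : 0 < ellipsoidalNorm α β e x := by
  refine Real.sqrt_pos.2 ?_
  have h := abs_real_inner_le_norm x e
  rw [he, mul_one] at h
  have h2 : (inner ℝ x e) ^ 2 ≤ ‖x‖ ^ 2 := sq_le_sq' (abs_le.1 h).1 (abs_le.1 h).2
  have : 0 < ‖x‖ ^ 2 := by positivity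
  nlinarith

lemma ellipsoidalNorm_lt {α β : ℝ} (hβ : 0 < β) (hαβ : β < α) {e : RVec p}
    (he : ‖e‖ = 1) {x y : RVec p} (hxy : ‖x‖ = ‖y‖) (h : |inner ℝ y e| < |inner ℝ x e|) :
    ellipsoidalNorm α β e x < ellipsoidalNorm α β e y := by
  have hx : x ≠ 0 := by
    rintro rfl
    simp only [inner_zero_left, abs_zero] at h
    exact absurd h (abs_nonneg _).not_gt
  refine Real.sqrt_lt_sqrt (Real.sqrt_pos.1 (ellipsoidalNorm_pos hβ hαβ he hx)).le ?_
  rw [hxy]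
  have := sq_lt_sq.2 h
  nlinarith

lemma measurable_ellipsoidalNorm (α β : ℝ) (e : RVec p) :
    Measurable (ellipsoidalNorm α β e) := by
  unfold ellipsoidalNorm
  fun_prop

/-- The strict case of Cauchy–Schwarz, read off from `‖w - v‖ ^ 2 > 0` and `‖w + v‖ ^ 2 > 0`. -/
lemma abs_inner_lt_of_norm_eq {v w : RVec p} (h : ‖v‖ = ‖w‖) (h1 : v ≠ w) (h2 : v ≠ -w) :
    |inner ℝ w v| < |inner ℝ w w| := by
  rw [real_inner_self_eq_norm_sq, abs_of_nonneg (sq_nonneg ‖w‖), abs_lt]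
  have e1 : 0 < ‖w - v‖ ^ 2 := by
    have : w - v ≠ 0 := sub_ne_zero.2 h1.symm
    positivity
  have e2 : 0 < ‖w + v‖ ^ 2 := by
    have : w + v ≠ 0 := fun h => h2 (eq_neg_of_add_eq_zero_right h)
    positivity
  rw [norm_sub_sq_real, h] at e1
  rw [norm_add_sq_real, h] at e2
  constructor <;> linarith

/-- Among the vectors of a given norm, those in the direction `e` of the long axis minimize the
objective function. -/
lemma objective_lt_of_density {h : ℝ → ℝ} (hm : Measurable h) (h0 : ∀ r, 0 ≤ h r)
    (hanti : StrictAntiOn h (Set.Ioi 0)) {α β : ℝ} (hβ : 0 < β) (hαβ : β < α) {e : RVec p}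
    (he : ‖e‖ = 1) {P : Measure (RVec p)} [IsProbabilityMeasure P]
    (hP : P = (volume : Measure (RVec p)).withDensity
      (fun x => ENNReal.ofReal (h (ellipsoidalNorm α β e x))))
    {s : ℝ} (hs : 0 < s) {v : RVec p} (hv : ‖v‖ = s) (h1 : v ≠ s • e) (h2 : v ≠ -(s • e)) :
    objective P (s • e) < objective P v := by
  set w := s • e with hw
  have hvw : ‖v‖ = ‖w‖ := by rw [hv, hw, norm_smul, he, mul_one, Real.norm_of_nonneg hs.le]
  obtain ⟨T, hTv, hTw⟩ := exists_isometry_apply_eq hvw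
  set G : RVec p → ℝ := fun x => h (ellipsoidalNorm α β e x)
  have hG0 : ∀ x, 0 ≤ G x := fun x => h0 _
  have hGm : Measurable G := hm.comp (measurable_ellipsoidalNorm _ _ _)
  -- The reflection `T` swaps `v` and `w`, so `D` is odd under it, and twice the difference of the
  -- objectives is the integral of `(G - G ∘ T) * D`. Both factors are positive where `x` is more
  -- aligned with `w` than with `v`, and they change sign together.
  set D : RVec p → ℝ := fun x => (‖x - v‖ * ‖x + v‖ - ‖x‖ ^ 2) - (‖x - w‖ * ‖x + w‖ - ‖x‖ ^ 2)
  have hDT (x : RVec p) : D (T x) = -D x := by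
    have e1 : ‖T x - v‖ * ‖T x + v‖ = ‖x - w‖ * ‖x + w‖ := by
      rw [← hTw, ← map_sub, ← map_add, T.norm_map, T.norm_map]
    have e2 : ‖T x - w‖ * ‖T x + w‖ = ‖x - v‖ * ‖x + v‖ := by
      rw [← hTv, ← map_sub, ← map_add, T.norm_map, T.norm_map]
    simp only [D, e1, e2, T.norm_map]
    ring
  have hGd : Measurable fun x => ENNReal.ofReal (G x) := hGm.ennreal_ofReal
  have hfin : ∀ᵐ x : RVec p, ENNReal.ofReal (G x) < ⊤ := .of_forall fun x => ENNReal.ofReal_lt_top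
  have hDP : Integrable D P := (integrable_objective P v).sub (integrable_objective P w)
  have hDG : Integrable (fun x => G x * D x) := by
    have := hDP
    rw [hP, integrable_withDensity_iff_integrable_smul' hGd hfin] at this
    simpa only [ENNReal.toReal_ofReal (hG0 _), smul_eq_mul] using this
  have hTe : MeasurableEmbedding T := T.toHomeomorph.measurableEmbedding
  have hDGT : Integrable (fun x => G (T x) * D x) := by
    have := (T.measurePreserving.integrable_comp_emb hTe).2 hDG
    refine this.neg.congr (.of_forall fun x => ?_)
    simp [hDT]
  have hI : objective P v - objective P w = ∫ x, G x * D x := by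
    rw [objective, objective,
      ← integral_sub (integrable_objective P v) (integrable_objective P w), hP,
      integral_withDensity_eq_integral_toReal_smul hGd hfin]
    simp only [ENNReal.toReal_ofReal (hG0 _), smul_eq_mul, D, G]
  have hI2 : ∫ x, G x * D x = -∫ x, G (T x) * D x := by
    rw [← T.measurePreserving.integral_comp hTe, ← integral_neg]
    simp [hDT]
  have hxw (x : RVec p) : |inner ℝ x w| = s * |inner ℝ x e| := by
    rw [hw, inner_smul_right, abs_mul, abs_of_pos hs]
  have hxv (x : RVec p) : |inner ℝ x v| = s * |inner ℝ (T x) e| := by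
    rw [← hxw, ← hTv, T.inner_map_map]
  have hpos : ∀ x, |inner ℝ x v| < |inner ℝ x w| → 0 < G x * D x - G (T x) * D x := by
    intro x hx
    have hD : 0 < D x := by
      have := norm_sub_mul_norm_add_lt_of_abs_inner_lt x hvw.symm hx
      simp only [D]
      linarith
    rw [hxw, hxv, mul_lt_mul_iff_right₀ hs] at hx
    have hx0 : x ≠ 0 := by
      rintro rfl
      simp at hx
    have hG : G (T x) < G x := hanti (ellipsoidalNorm_pos hβ hαβ he hx0)
      (ellipsoidalNorm_pos hβ hαβ he (by simpa using hx0))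
      (ellipsoidalNorm_lt hβ hαβ he (T.norm_map x).symm hx)
    nlinarith
  have hnonneg : ∀ x, 0 ≤ G x * D x - G (T x) * D x := by
    intro x
    rcases lt_trichotomy |inner ℝ x v| |inner ℝ x w| with hx | hx | hx
    · exact (hpos x hx).le
    · have hD : D x = 0 := by
        simp only [D, norm_sub_mul_norm_add_eq_of_abs_inner_eq x hvw hx.symm, sub_self]
      simp [hD]
    · have hD : D x < 0 := by
        have := norm_sub_mul_norm_add_lt_of_abs_inner_lt x hvw hx
        simp only [D]
        linarith
      rw [hxw, hxv, mul_lt_mul_iff_right₀ hs] at hx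
      have hx0 : x ≠ 0 := by
        rintro rfl
        simp at hx
      have hG : G x < G (T x) := hanti (ellipsoidalNorm_pos hβ hαβ he (by simpa using hx0))
        (ellipsoidalNorm_pos hβ hαβ he hx0) (ellipsoidalNorm_lt hβ hαβ he (T.norm_map x) hx)
      nlinarith
  have hint : 0 < ∫ x, (G x * D x - G (T x) * D x) := by
    rw [integral_pos_iff_support_of_nonneg hnonneg (hDG.sub hDGT)]
    -- Strictness: the integrand is positive on an open set that contains `w`.
    have hU : IsOpen {x : RVec p | |inner ℝ x v| < |inner ℝ x w|} :=
      isOpen_lt (by fun_prop) (by fun_prop)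
    refine (hU.measure_pos volume ⟨w, abs_inner_lt_of_norm_eq hvw h1 h2⟩).trans_le
      (measure_mono fun x hx => (hpos x hx).ne')
  rw [integral_sub hDG hDGT] at hint
  linarith

/-- The law of `Λ Z` has a density whose level sets are ellipsoids with long axis `e₁`. -/
lemma exists_density_map_scaleMatrix [NeZero p] {ν : Measure (RVec p)} (hν : IsGenerator ν)
    {σ lam : ℝ} (hσ : 0 < σ) (hl : 1 < lam) :
    ∃ h : ℝ → ℝ, ∃ α β : ℝ, Measurable h ∧ (∀ r, 0 ≤ h r) ∧ (∀ r, 0 < r → 0 < h r) ∧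
      StrictAntiOn h (Set.Ioi 0) ∧ 0 < β ∧ β < α ∧
      ν.map (matAct (scaleMatrix p σ lam)) = (volume : Measure (RVec p)).withDensity
        (fun x => ENNReal.ofReal (h (ellipsoidalNorm α β (EuclideanSpace.single 0 1) x))) := by
  obtain ⟨g, hgm, hg0, hgpos, hanti, hνg⟩ := hν.exists_density
  set A := matAct (scaleMatrix p σ lam) with hA
  have hinj : Function.Injective A := by
    refine (injective_iff_map_eq_zero A).2 fun x hx => ?_
    have := le_norm_matAct_scaleMatrix hσ hl.le x
    rw [← hA, hx, norm_zero] at this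
    exact norm_le_zero_iff.1 (nonpos_of_mul_nonpos_right this hσ)
  have hdet : LinearMap.det A ≠ 0 := by
    have := (LinearEquiv.ofInjectiveEndo A hinj).isUnit_det'.ne_zero
    rwa [show (LinearEquiv.ofInjectiveEndo A hinj).toLinearMap = A from
      LinearMap.ext fun x => rfl] at this
  set c := |(LinearMap.det A)⁻¹|
  have hc : 0 < c := abs_pos.2 (inv_ne_zero hdet)
  have hl0 : 0 < lam := by linarith
  have hAm : Measurable A := (continuous_matAct _).measurable
  have hvol : (volume : Measure (RVec p)).map A = ENNReal.ofReal c • volume :=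
    Measure.map_linearMap_addHaar_eq_smul_addHaar _ hdet
  have hl2 : (lam ^ 2)⁻¹ < 1 := inv_lt_one_of_one_lt₀ (by nlinarith)
  have hl2' : 0 < (lam ^ 2)⁻¹ := by positivity
  have hσ2 : 0 < (σ ^ 2)⁻¹ := by positivity
  -- Chosen so that the ellipsoidal norm of `A z` is `‖z‖`; `lam > 1` gives `0 < β < α`.
  set α := (σ ^ 2)⁻¹
  set β := (σ ^ 2)⁻¹ * (1 - (lam ^ 2)⁻¹)
  have hnorm (z : RVec p) :
      ellipsoidalNorm α β (EuclideanSpace.single 0 1) (A z) = ‖z‖ := by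
    have hz : ‖A z‖ ^ 2 = σ ^ 2 * ‖z‖ ^ 2 + σ ^ 2 * (lam ^ 2 - 1) * z 0 ^ 2 := by
      have (i : Fin p) : (A z i) ^ 2 =
          σ ^ 2 * z i ^ 2 + if i = 0 then σ ^ 2 * (lam ^ 2 - 1) * z i ^ 2 else 0 := by
        rw [hA, matAct_scaleMatrix_apply]
        split_ifs <;> ring
      rw [EuclideanSpace.real_norm_sq_eq, EuclideanSpace.real_norm_sq_eq]
      simp_rw [this]
      rw [Finset.sum_add_distrib, ← Finset.mul_sum, Finset.sum_ite_eq' Finset.univ]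
      simp
    have hz0 : inner ℝ (A z) (EuclideanSpace.single 0 (1 : ℝ)) = σ * lam * z 0 := by
      simp [EuclideanSpace.inner_single_right, hA, matAct_scaleMatrix_apply]
    rw [ellipsoidalNorm, hz, hz0, ← Real.sqrt_sq (norm_nonneg z)]
    congr 1
    simp only [α, β]
    rw [Real.sqrt_sq (norm_nonneg z)]
    field_simp
    ring
  refine ⟨fun r => c * g r, α, β, hgm.const_mul c, fun r => mul_nonneg hc.le (hg0 r),
    fun r hr => mul_pos hc (hgpos r hr),
    fun r hr s hs hrs => mul_lt_mul_of_pos_left (hanti hr hs hrs) hc,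
    mul_pos hσ2 (by linarith), by simp only [α, β]; nlinarith, ?_⟩
  ext s hs
  have hm : Measurable fun x : RVec p => ENNReal.ofReal
      (g (ellipsoidalNorm α β (EuclideanSpace.single 0 1) x)) :=
    (hgm.comp (measurable_ellipsoidalNorm _ _ _)).ennreal_ofReal
  rw [Measure.map_apply hAm hs, hνg, withDensity_apply _ (hAm hs), withDensity_apply _ hs]
  simp_rw [← hnorm]
  rw [← setLIntegral_map hs hm hAm, hvol, Measure.restrict_smul, lintegral_smul_measure,
    smul_eq_mul, ← lintegral_const_mul _ hm]
  simp_rw [ENNReal.ofReal_mul hc.le]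

end Direction

/-! ### Uniqueness of the minimizer -/

section Uniqueness

variable {p : ℕ}

/-- On a ray, the objective function is strictly midpoint convex in the squared norm. -/
lemma two_mul_objective_lt (P : Measure (RVec p)) [IsProbabilityMeasure P] [P.IsOpenPosMeasure]
    {e : RVec p} (he : ‖e‖ = 1) {r s t : ℝ} (h : 2 * r ^ 2 = s ^ 2 + t ^ 2)
    (hst : s ^ 2 ≠ t ^ 2) :
    2 * objective P (r • e) < objective P (s • e) + objective P (t • e) := by
  have hi := integrable_objective P
  have hst' : Integrable (fun x => (‖x - s • e‖ * ‖x + s • e‖ - ‖x‖ ^ 2)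
      + (‖x - t • e‖ * ‖x + t • e‖ - ‖x‖ ^ 2)) P := (hi _).add (hi _)
  have h0 : 0 < ∫ x, ((‖x - s • e‖ * ‖x + s • e‖ - ‖x‖ ^ 2)
      + (‖x - t • e‖ * ‖x + t • e‖ - ‖x‖ ^ 2)
      - 2 * (‖x - r • e‖ * ‖x + r • e‖ - ‖x‖ ^ 2)) ∂P := by
    -- At `x = r • e` the continuous integrand equals `|r ^ 2 - s ^ 2| + |r ^ 2 - t ^ 2|`, which is
    -- not zero.
    refine integral_pos_of_integrable_nonneg_nonzero (x := r • e) (by fun_prop)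
      (hst'.sub ((hi _).const_mul 2)) (fun x => ?_) ?_
    · have := norm_sub_mul_norm_add_midpoint_le x e he h
      simp only [Pi.zero_apply]
      linarith
    · have key (a : ℝ) : ‖r • e - a • e‖ * ‖r • e + a • e‖ = |r ^ 2 - a ^ 2| := by
        rw [← sub_smul, ← add_smul, norm_smul, norm_smul, he, mul_one, mul_one,
          Real.norm_eq_abs, Real.norm_eq_abs, ← abs_mul]
        congr 1; ring
      rw [key, key, key, sub_self, abs_zero]
      have : 0 < |r ^ 2 - s ^ 2| := abs_pos.2 fun h' => hst (by linarith)
      have : 0 ≤ |r ^ 2 - t ^ 2| := abs_nonneg _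
      intro h'
      linarith
  rw [integral_sub hst' ((hi _).const_mul 2), integral_add (hi _) (hi _),
    integral_const_mul] at h0
  simp only [objective]
  linarith

/-- A coercive objective function whose minimizers lie in the direction of `e` has exactly one
minimizer up to sign. -/
lemma exists_isMinimizerNorm (P : Measure (RVec p)) [IsProbabilityMeasure P]
    [P.IsOpenPosMeasure] {e : RVec p} (he : ‖e‖ = 1)
    (hdir : ∀ s, 0 < s → ∀ v, ‖v‖ = s → v ≠ s • e → v ≠ -(s • e) →
      objective P (s • e) < objective P v)
    {R : ℝ} (hR : ∀ v, R ≤ ‖v‖ → 0 < objective P v) :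
    ∃ ψ, IsMinimizerNorm P e ψ := by
  obtain ⟨v₀, hv₀⟩ : ∃ v₀, v₀ ∈ minimizers P := by
    have hev : ∀ᶠ v in cocompact (RVec p), objective P 0 ≤ objective P v := by
      filter_upwards [tendsto_norm_cocompact_atTop.eventually_ge_atTop R] with v hv
      simpa using (hR v hv).le
    exact (continuous_objective P).exists_forall_le' 0 hev
  have hray : ∀ v ∈ minimizers P, v = ‖v‖ • e ∨ v = -(‖v‖ • e) := by
    intro v hv
    rcases eq_or_ne v 0 with rfl | h0
    · simp
    by_contra! hne
    exact (hdir ‖v‖ (norm_pos_iff.2 h0) v rfl hne.1 hne.2).not_ge (hv _)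
  have hval : ∀ v ∈ minimizers P, objective P (‖v‖ • e) = objective P v := by
    intro v hv
    rcases hray v hv with h | h
    · rw [← h]
    · rw [h, objective_neg, norm_neg, norm_smul, he, mul_one, norm_norm]
  refine ⟨‖v₀‖, norm_nonneg _, ?_⟩
  have hmem : ‖v₀‖ • e ∈ minimizers P := fun w => by
    rw [hval v₀ hv₀]
    exact hv₀ w
  ext v
  simp only [Set.mem_insert_iff, Set.mem_singleton_iff]
  constructor
  · intro hv
    have hn : ‖v‖ = ‖v₀‖ := by
      by_contra hne
      -- For two minimizers of different norms, the point of the ray whose squared norm is their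
      -- mean would have a smaller value.
      have h1 := two_mul_objective_lt P he (r := √((‖v‖ ^ 2 + ‖v₀‖ ^ 2) / 2)) (s := ‖v‖)
        (t := ‖v₀‖) (by rw [Real.sq_sqrt (by positivity)]; ring)
        (fun h => hne ((sq_eq_sq₀ (norm_nonneg _) (norm_nonneg _)).1 h))
      rw [hval v hv, hval v₀ hv₀] at h1
      have h2 := hv (√((‖v‖ ^ 2 + ‖v₀‖ ^ 2) / 2) • e)
      have h3 := hv₀ (√((‖v‖ ^ 2 + ‖v₀‖ ^ 2) / 2) • e)
      linarith
    rw [← hn]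
    exact hray v hv
  · rintro (rfl | rfl)
    · exact hmem
    · intro w
      rw [objective_neg]
      exact hmem w

end Uniqueness

/-! ### Large `λ` -/

section Asymptotics

variable {p : ℕ} [NeZero p] {ν : Measure (RVec p)}

omit [NeZero p] in
-- Supplies the coercivity radius. The truncation at one permits dominated convergence even when the
-- second moment is infinite.
lemma exists_integral_min_lt_half [IsProbabilityMeasure ν] :
    ∃ b : ℝ, 0 < b ∧ ∫ z, min (‖z‖ ^ 2 / b) 1 ∂ν < 1 / 2 := by
  have h : Tendsto (fun b : ℝ => ∫ z, min (‖z‖ ^ 2 / b) 1 ∂ν) atTop (nhds (∫ _, 0 ∂ν)) := by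
    refine tendsto_integral_filter_of_dominated_convergence (fun _ => 1)
      (.of_forall fun b => by fun_prop) ?_ (integrable_const _) (.of_forall fun z => ?_)
    · filter_upwards [eventually_gt_atTop 0] with b hb
      refine .of_forall fun z => ?_
      rw [Real.norm_of_nonneg (by positivity)]
      exact min_le_right _ _
    · have : Tendsto (fun b : ℝ => min (‖z‖ ^ 2 / b) 1) atTop (nhds (min 0 1)) :=
        (tendsto_const_nhds.div_atTop tendsto_id).min tendsto_const_nhds
      simpa using this
  rw [integral_zero] at h
  obtain ⟨b, hb, hb'⟩ :=
    ((eventually_gt_atTop 0).and (h.eventually_lt_const (by norm_num : (0 : ℝ) < 1 / 2))).exists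
  exact ⟨b, hb, hb'⟩

/-- The integrand is at least `-‖v‖ ^ 2` and at least `‖v‖ ^ 2 - 2 * ‖A z‖ ^ 2`, and here `‖A z‖ ^ 2
≤ ‖v‖ ^ 2 * (‖z‖ ^ 2 / b)`. Together these give the lower bound `‖v‖ ^ 2 * (1 - 2 * min (‖z‖ ^ 2 /
b) 1)`, whose mean is positive. -/
lemma objective_pos_of_sq_norm_ge [IsProbabilityMeasure ν] {b : ℝ} (hb : 0 < b)
    (hb2 : ∫ z, min (‖z‖ ^ 2 / b) 1 ∂ν < 1 / 2) {σ lam : ℝ} (hσ : 0 < σ) (hl : 1 ≤ lam)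
    {v : RVec p} (hv : b * (σ * lam) ^ 2 ≤ ‖v‖ ^ 2) :
    0 < objective (ν.map (matAct (scaleMatrix p σ lam))) v := by
  rw [objective_map]
  set A := matAct (scaleMatrix p σ lam)
  have hA : Measurable A := (continuous_matAct _).measurable
  have hl0 : 0 < lam := by linarith
  have hv0 : 0 < ‖v‖ ^ 2 := lt_of_lt_of_le (by positivity) hv
  have hmin : Integrable (fun z : RVec p => min (‖z‖ ^ 2 / b) 1) ν := by
    refine Integrable.of_bound (by fun_prop) 1 (.of_forall fun z => ?_)
    rw [Real.norm_of_nonneg (by positivity)]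
    exact min_le_right _ _
  have hI : Integrable (fun z : RVec p => ‖v‖ ^ 2 - 2 * ‖v‖ ^ 2 * min (‖z‖ ^ 2 / b) 1) ν :=
    (integrable_const _).sub (hmin.const_mul _)
  have h1 : ∫ z, (‖v‖ ^ 2 - 2 * ‖v‖ ^ 2 * min (‖z‖ ^ 2 / b) 1) ∂ν ≤
      ∫ z, (‖A z - v‖ * ‖A z + v‖ - ‖A z‖ ^ 2) ∂ν := by
    refine integral_mono hI (Integrable.of_bound (by fun_prop) (‖v‖ ^ 2)
      (.of_forall fun x => by simpa using abs_norm_sub_mul_norm_add_sub_sq_le (A x) v))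
      fun z => ?_
    have h2 := norm_matAct_scaleMatrix_le hσ hl z
    have h3 : ‖A z‖ ^ 2 ≤ ‖v‖ ^ 2 * (‖z‖ ^ 2 / b) := by
      calc ‖A z‖ ^ 2 ≤ (σ * lam * ‖z‖) ^ 2 := by gcongr
        _ = b * (σ * lam) ^ 2 * (‖z‖ ^ 2 / b) := by field_simp
        _ ≤ _ := by gcongr
    have h4 := abs_le.1 (abs_norm_sub_mul_norm_add_sub_sq_le (A z) v)
    have h7 := abs_sq_sub_sq_le_norm_sub_mul_norm_add (A z) v
    have h8 := neg_le_abs (‖A z‖ ^ 2 - ‖v‖ ^ 2)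
    simp only
    rcases min_choice (‖z‖ ^ 2 / b) 1 with h | h <;> rw [h] <;> nlinarith
  refine lt_of_lt_of_le ?_ h1
  rw [integral_sub (integrable_const _) (hmin.const_mul _), integral_const_mul]
  simp only [integral_const, probReal_univ, smul_eq_mul]
  nlinarith

/-- Homogeneity of degree two; after this rescaling the integral has a limit as `lam` grows. -/
lemma objective_map_scaleMatrix_smul {σ lam : ℝ} (hc : 0 < σ * lam) (w : RVec p) :
    objective (ν.map (matAct (scaleMatrix p σ lam))) ((σ * lam) • w) =
      (σ * lam) ^ 2 * ∫ z, (‖(σ * lam)⁻¹ • matAct (scaleMatrix p σ lam) z - w‖ *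
        ‖(σ * lam)⁻¹ • matAct (scaleMatrix p σ lam) z + w‖ -
        ‖(σ * lam)⁻¹ • matAct (scaleMatrix p σ lam) z‖ ^ 2) ∂ν := by
  rw [objective_map, ← integral_const_mul]
  refine integral_congr_ae (.of_forall fun z => ?_)
  obtain ⟨y, hy⟩ : ∃ y, y = (σ * lam)⁻¹ • matAct (scaleMatrix p σ lam) z := ⟨_, rfl⟩
  have : matAct (scaleMatrix p σ lam) z = (σ * lam) • y := by
    rw [hy, smul_inv_smul₀ hc.ne']
  simp only [← hy]
  simp only [this, ← smul_sub, ← smul_add, norm_smul, Real.norm_of_nonneg hc.le]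
  ring

/-- After normalization, `Λ Z` converges to its first coordinate. -/
lemma tendsto_smul_matAct_scaleMatrix {σ : ℝ} (hσ : 0 < σ) (z : RVec p) :
    Tendsto (fun lam : ℝ => (σ * lam)⁻¹ • matAct (scaleMatrix p σ lam) z) atTop
      (nhds (z 0 • EuclideanSpace.single 0 1)) := by
  have h : Tendsto (fun lam : ℝ => z 0 • EuclideanSpace.single 0 (1 : ℝ) +
      lam⁻¹ • (z - z 0 • EuclideanSpace.single 0 (1 : ℝ))) atTop
      (nhds (z 0 • EuclideanSpace.single 0 1 +
        (0 : ℝ) • (z - z 0 • EuclideanSpace.single 0 (1 : ℝ)))) :=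
    tendsto_const_nhds.add (tendsto_inv_atTop_zero.smul_const _)
  rw [zero_smul, add_zero] at h
  refine h.congr' ?_
  filter_upwards [eventually_gt_atTop 0] with lam hl
  ext i
  rw [PiLp.smul_apply, matAct_scaleMatrix_apply]
  rcases eq_or_ne i 0 with rfl | hi
  · simp
    field_simp
  · simp [hi]
    field_simp

/-- The limiting objective function, that of the law of the first coordinate, takes negative
values. -/
lemma exists_integral_abs_sub_neg [IsProbabilityMeasure ν] (h0 : ∀ᵐ z ∂ν, z 0 ≠ 0) :
    ∃ t : ℝ, 0 < t ∧ ∫ z, (|z 0 - t| * |z 0 + t| - z 0 ^ 2) ∂ν < 0 := by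
  -- The quotient is bounded by one in absolute value and equals `-1` as soon as `t < |z 0|`.
  have h : Tendsto (fun t : ℝ => ∫ z, (|z 0 - t| * |z 0 + t| - z 0 ^ 2) / t ^ 2 ∂ν)
      (nhdsWithin 0 (Set.Ioi 0)) (nhds (∫ _, -1 ∂ν)) := by
    refine tendsto_integral_filter_of_dominated_convergence (fun _ => 1)
      (.of_forall fun b => Measurable.aestronglyMeasurable (by fun_prop)) ?_
      (integrable_const _) ?_
    · filter_upwards [self_mem_nhdsWithin] with t ht
      refine .of_forall fun z => ?_
      have ht : 0 < t := ht
      have := abs_norm_sub_mul_norm_add_sub_sq_le (z 0) t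
      simp only [Real.norm_eq_abs, sq_abs] at this
      rw [norm_div, Real.norm_eq_abs, Real.norm_of_nonneg (sq_nonneg t)]
      exact div_le_one_of_le₀ this (by positivity)
    · filter_upwards [h0] with z hz
      refine tendsto_const_nhds.congr' ?_
      filter_upwards [Ioo_mem_nhdsGT (abs_pos.2 hz)] with t ht
      have h1 : t ^ 2 < z 0 ^ 2 := by
        rw [← sq_abs (z 0)]
        exact pow_lt_pow_left₀ ht.2 ht.1.le two_ne_zero
      have ht0 : t ^ 2 ≠ 0 := by have := ht.1; positivity
      rw [← abs_mul, abs_of_nonneg (by nlinarith), eq_div_iff ht0]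
      ring
  simp only [integral_const, probReal_univ, one_smul] at h
  obtain ⟨t, ht, ht'⟩ := ((eventually_mem_nhdsWithin (a := (0 : ℝ))).and
    (h.eventually_lt_const (by norm_num : (-1 : ℝ) < 0))).exists
  have ht : 0 < t := ht
  refine ⟨t, ht, ?_⟩
  rw [integral_div] at ht'
  by_contra! hge
  exact ht'.not_ge (by positivity)

/-- The rescaled objective at `t e₁` tends to the negative number `L`, so it is eventually below `L
/ 2`; undoing the scaling gives the factor `(σ * lam) ^ 2`. -/
lemma exists_eventually_objective_lt [IsProbabilityMeasure ν] (h0 : ∀ᵐ z ∂ν, z 0 ≠ 0)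
    {σ : ℝ} (hσ : 0 < σ) :
    ∃ a : ℝ, 0 < a ∧ ∀ᶠ lam : ℝ in atTop, ∃ w : RVec p,
      objective (ν.map (matAct (scaleMatrix p σ lam))) w < -(a * (σ * lam) ^ 2) := by
  obtain ⟨t, ht, hL⟩ := exists_integral_abs_sub_neg h0
  set L := ∫ z, (|z 0 - t| * |z 0 + t| - z 0 ^ 2) ∂ν
  let w : RVec p := t • EuclideanSpace.single 0 1
  have h : Tendsto (fun lam : ℝ => ∫ z, (‖(σ * lam)⁻¹ • matAct (scaleMatrix p σ lam) z - w‖ *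
        ‖(σ * lam)⁻¹ • matAct (scaleMatrix p σ lam) z + w‖ -
        ‖(σ * lam)⁻¹ • matAct (scaleMatrix p σ lam) z‖ ^ 2) ∂ν) atTop (nhds L) := by
    refine tendsto_integral_filter_of_dominated_convergence (fun _ => ‖w‖ ^ 2)
      (.of_forall fun lam => ?_)
      (.of_forall fun lam => .of_forall fun z => abs_norm_sub_mul_norm_add_sub_sq_le _ _)
      (integrable_const _) (.of_forall fun z => ?_)
    · have hA : Measurable (matAct (scaleMatrix p σ lam)) := (continuous_matAct _).measurable
      fun_prop
    · have hy := tendsto_smul_matAct_scaleMatrix hσ z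
      have := ((hy.sub_const w).norm.mul (hy.add_const w).norm).sub (hy.norm.pow 2)
      convert this using 2
      simp only [w, ← sub_smul, ← add_smul, norm_smul]
      simp
  refine ⟨-L / 2, by linarith, ?_⟩
  filter_upwards [h.eventually_lt_const (by linarith : L < L / 2), eventually_gt_atTop 0]
    with lam h1 hl
  refine ⟨(σ * lam) • w, ?_⟩
  rw [objective_map_scaleMatrix_smul (by positivity)]
  have : 0 < (σ * lam) ^ 2 := by positivity
  nlinarith

/-- A law with a density does not charge the hyperplane `z 0 = 0`. -/
lemma IsGenerator.ae_apply_zero_ne_zero (hν : IsGenerator ν) : ∀ᵐ z ∂ν, z 0 ≠ 0 := by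
  obtain ⟨g, -, -, -, -, hg⟩ := hν.exists_density
  have hac : ν ≪ volume := hg ▸ withDensity_absolutelyContinuous _ _
  let S : Submodule ℝ (RVec p) := 
    LinearMap.ker (EuclideanSpace.proj (𝕜 := ℝ) (0 : Fin p)).toLinearMap
  have hS : S ≠ ⊤ := by
    intro h
    have : EuclideanSpace.single (0 : Fin p) (1 : ℝ) ∈ S := h ▸ Submodule.mem_top
    simp [S] at this
  have := hac (Measure.addHaar_submodule volume S hS)
  rw [ae_iff]
  convert this using 2
  ext z
  simp [S]

/-- For large `λ`, the norm of the minimizer exists and is of the exact order `λ`. -/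
lemma IsGenerator.eventually_exists_isMinimizerNorm (hν : IsGenerator ν) {σ : ℝ} (hσ : 0 < σ) :
    ∃ a b : ℝ, 0 < a ∧ 0 < b ∧ ∀ᶠ lam : ℝ in atTop, ∃ ψ,
      IsMinimizerNorm (ν.map (matAct (scaleMatrix p σ lam))) (EuclideanSpace.single 0 1) ψ ∧
      a * lam < ψ ∧ ψ < b * lam := by
  have := hν.prob
  obtain ⟨a, ha, hlow⟩ := exists_eventually_objective_lt hν.ae_apply_zero_ne_zero hσ
  obtain ⟨b, hb, hmin⟩ := exists_integral_min_lt_half (ν := ν)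
  -- Lower constant: the minimum is below `-(a * (σ * lam) ^ 2)` and at least `-ψ ^ 2`. Upper
  -- constant: the objective is positive from radius `√b * (σ * lam)` on, but at the minimizer it is
  -- at most its value `0` at the origin.
  refine ⟨√a * σ, √b * σ, by positivity, by positivity, ?_⟩
  filter_upwards [hlow, eventually_gt_atTop 1] with lam ⟨w, hw⟩ hl
  have hl0 : 0 < lam := by linarith
  have hc : 0 < σ * lam := by positivity
  set P := ν.map (matAct (scaleMatrix p σ lam)) with hPdef
  have : IsProbabilityMeasure P :=
    Measure.isProbabilityMeasure_map (continuous_matAct _).measurable.aemeasurable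
  have he : ‖(EuclideanSpace.single 0 1 : RVec p)‖ = 1 := by simp
  obtain ⟨h, α, β, hm, h0, hpos, hanti, hβ, hαβ, hP⟩ := exists_density_map_scaleMatrix hν hσ hl
  -- The density is positive away from the origin, so Lebesgue measure is absolutely continuous with
  -- respect to `P`.
  have hopen : P.IsOpenPosMeasure := by
    have hac : (volume : Measure (RVec p)) ≪ P := by
      rw [hPdef, hP]
      refine withDensity_absolutelyContinuous'
        (hm.comp (measurable_ellipsoidalNorm _ _ _)).ennreal_ofReal.aemeasurable ?_
      have : ∀ᵐ x : RVec p, x ≠ 0 := by simp [ae_iff]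
      filter_upwards [this] with x hx
      simpa using hpos _ (ellipsoidalNorm_pos hβ hαβ he hx)
    exact hac.isOpenPosMeasure
  have hcoer : ∀ v : RVec p, √b * (σ * lam) ≤ ‖v‖ → 0 < objective P v := by
    intro v hv
    refine objective_pos_of_sq_norm_ge hb hmin hσ hl.le ?_
    calc b * (σ * lam) ^ 2 = (√b * (σ * lam)) ^ 2 := by rw [mul_pow (√b), Real.sq_sqrt hb.le]
      _ ≤ _ := by gcongr
  obtain ⟨ψ, hψ⟩ := exists_isMinimizerNorm P he
    (fun s hs v hv h1 h2 => objective_lt_of_density hm h0 hanti hβ hαβ he hP hs hv h1 h2) hcoer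
  have hmem : ψ • (EuclideanSpace.single 0 1 : RVec p) ∈ minimizers P := by
    rw [hψ.2]; exact Set.mem_insert _ _
  have hnorm : ‖ψ • (EuclideanSpace.single 0 1 : RVec p)‖ = ψ := by
    rw [norm_smul, he, mul_one, Real.norm_of_nonneg hψ.1]
  refine ⟨ψ, hψ, ?_, ?_⟩
  · have h1 := neg_sq_norm_le_objective P (ψ • (EuclideanSpace.single 0 1 : RVec p))
    rw [hnorm] at h1
    have h2 := hmem w
    refine lt_of_pow_lt_pow_left₀ 2 hψ.1 ?_
    rw [mul_assoc, mul_pow, Real.sq_sqrt ha.le]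
    linarith
  · by_contra! hge
    have h1 := hcoer _ (by rw [hnorm]; linarith)
    have h2 := hmem 0
    rw [objective_zero] at h2
    linarith

end Asymptotics

theorem mainTheorem3 :
    (∀ lam : ℝ, 1 < lam → ∃ N : ℕ, ∀ (p : ℕ) [NeZero p], N ≤ p →
      ∀ σ : ℝ, 0 < σ → ∀ O ∈ Matrix.orthogonalGroup (Fin p) ℝ,
        ∀ P ∈ EllipticalFamily O (scaleMatrix p σ lam),
          IsMinimizerNorm P (firstColumn O) 0) ∧
    (∀ (p : ℕ) [NeZero p] (ν : Measure (RVec p)), IsGenerator ν →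
      ∀ σ : ℝ, 0 < σ → ∀ ε : ℝ, 0 < ε → ∀ᶠ lam : ℝ in atTop,
        ∃ ψ : ℝ,
          (∀ O ∈ Matrix.orthogonalGroup (Fin p) ℝ,
            IsMinimizerNorm (ellipticalLaw O (scaleMatrix p σ lam) ν) (firstColumn O) ψ) ∧
          lam ^ (1 - ε) < ψ ∧ ψ < lam ^ (1 + ε)) := by
  constructor
  · intro lam hl
    obtain ⟨N, hN⟩ := exists_nat_gt (2 * lam ^ 2)
    refine ⟨N, fun p _ hp σ hσ O hO P ⟨ν, hν, hP⟩ => ?_⟩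
    have := hν.prob
    rw [hP]
    refine IsMinimizerNorm.ellipticalLaw (isMinimizerNorm_zero_of_objective_pos fun v hv => ?_) hO
    exact objective_pos_of_lt hν.spherical hσ hl.le
      (hN.trans_le (by exact_mod_cast hp)) hv
  · intro p _ ν hν σ hσ ε hε
    obtain ⟨a, b, ha, hb, h⟩ := hν.eventually_exists_isMinimizerNorm hσ
    -- Eventually `lam ^ (-ε) < a` and `b < lam ^ ε`, which turns the linear bounds into the stated
    -- powers.
    filter_upwards [h, eventually_gt_atTop 0,
      (tendsto_rpow_neg_atTop hε).eventually_lt_const ha,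
      (tendsto_rpow_atTop hε).eventually_gt_atTop b] with lam ⟨ψ, hψ, h1, h2⟩ hl h3 h4
    refine ⟨ψ, fun O hO => hψ.ellipticalLaw hO, ?_, ?_⟩
    · rw [sub_eq_neg_add, Real.rpow_add hl, Real.rpow_one]
      exact (mul_lt_mul_of_pos_right h3 hl).trans h1
    · rw [add_comm, Real.rpow_add hl, Real.rpow_one]
      exact h2.trans (mul_lt_mul_of_pos_right h4 hl)
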